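/- Work in classical first-order logic with equality. An $L$ clause is a finite set of $L$ literals, read as the universal closure of their disjunction; an $L$ clause set is a set of $L$ clauses. Let $L$ be a first-order language containing a constant symbol $0$ and a unary function symbol $s$, and let $\eta$ be a constant symbol not in $L$. For an $L\cup\{\eta\}$ clause set $\mathcal C(\eta)$ and a term $t$, let $\mathcal C(t)$ be the result of replacing every occurrence of $\eta$ by $t$. A finite $L\cup\{\eta\}$ clause set $\mathcal C(\eta)$ is an $L$ clause set cycle if $\mathcal C(s(\eta))\models\mathcal C(\eta)$ and $\mathcal C(0)\models\bot$. An $L\cup\{\eta\}$ clause set $\mathcal D(\eta)$ is refuted by the $L$ clause set cycle $\mathcal C(\eta)$ if $\mathcal D(\eta)\models\mathcal C(\eta)$. By $\mathrm{IND}(\mathrm{Open}(L))$ we denote the theory axiomatized by the universal closures of $$\varphi(0,\vec z)\wedge\forall x\,(\varphi(x,\vec z)\to\varphi(s(x),\vec z))\to\forall x\,\varphi(x,\vec z)$$ for all quantifier-free $L$ formulas $\varphi(x,\vec z)$. Let $L_{\mathrm{LA}}=\{0,s,p,+\}$, with $p$ unary and $+$ binary. Let $B$ be the theory axiomatized by the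 universal closures of $s(0)\neq0$, $p(0)=0$, $p(s(x))=x$, $x+0=x$ and $x+s(y)=s(x+y)$. Let $B2$ be $x+y=y+x$ and let $B3$ be $x+(y+z)=(x+y)+z$. For $k\in\mathbb N$ let $\overline k=s^k(0)$, and for a term $t$ let $0\cdot t=0$ and $(i+1)\cdot t=t+(i\cdot t)$. For $k,n,m\in\mathbb N$ with $0<n<m$ let $E_{k,n,m}(x)$ be the formula $$n\cdot x+\overline{(m-n)k}=m\cdot x\;\to\;x=\overline k .$$ Let $\mathit{cls}$ be any function that assigns to every $\forall_1$ sentence of the language $L_{\mathrm{LA}}\cup\{\eta\}$ a logically equivalent clause set of that language (such functions exist), and put $\mathit{cls}(\Gamma)=\bigcup_{\gamma\in\Gamma}\mathit{cls}(\gamma)$ for a set $\Gamma$ of $\forall_1$ sentences. Let $$\mathcal E_{k,n,m}(\eta)=\mathit{cls}\bigl(B+B2+B3+\neg E_{k,n,m}(\eta)\bigr).$$ Then, for all $k,n,m\in\mathbb N$ with $0<n<m$: 1. the clause set $\mathcal E_{k,n,m}(\eta)$ is not refuted by any $L_{\mathrm{LA}}$ clause set cycle; 2. $\mathrm{IND}(\mathrm{Open}(L_{\mathrm{LA}}))\cup\mathcal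 E_{k,n,m}(\eta)$ is unsatisfiable. Consequently, there exist a first-order language $L$ and an $L\cup\{\eta\}$ clause set $\mathcal D(\eta)$ such that $\mathrm{IND}(\mathrm{Open}(L))\cup\mathcal D(\eta)$ is inconsistent, but $\mathcal D(\eta)$ is not refuted by any $L$ clause set cycle. -/

import Mathlib

namespace CSC

open FirstOrder FirstOrder.Language

universe u v

/-! ### Clauses and clause sets -/

/-- Atoms of `L` (first-order logic with equality), with variables indexed by `ℕ`. -/
inductive Atom (L : FirstOrder.Language.{u, v}) : Type (max u v)
  | eq (t₁ t₂ : L.Term ℕ) : Atom L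
  | rel {l : ℕ} (R : L.Relations l) (ts : Fin l → L.Term ℕ) : Atom L

/-- Literals: atoms and negated atoms. -/
inductive Literal (L : FirstOrder.Language.{u, v}) : Type (max u v)
  | pos (a : Atom L) : Literal L
  | neg (a : Atom L) : Literal L

/-- A clause is a finite set of literals. -/
abbrev Clause (L : FirstOrder.Language.{u, v}) : Type (max u v) := Finset (Literal L)

/-- A clause set is a (possibly infinite) set of clauses. -/
abbrev ClauseSet (L : FirstOrder.Language.{u, v}) : Type (max u v) := Set (Clause L)

section Semantics

variable {L : FirstOrder.Language.{u, v}} {M : Type*} [L.Structure M]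

/-- Truth of an atom under an assignment of the variables. -/
def Atom.Realize (w : ℕ → M) : Atom L → Prop
  | .eq t₁ t₂ => t₁.realize w = t₂.realize w
  | .rel R ts => Structure.RelMap R fun i => (ts i).realize w

/-- Truth of a literal under an assignment of the variables. -/
def Literal.Realize (w : ℕ → M) : Literal L → Prop
  | .pos a => a.Realize w
  | .neg a => ¬ a.Realize w

/-- Truth of the disjunction of the literals of a clause under an assignment. -/
def Clause.Realize (w : ℕ → M) (c : Clause L) : Prop := ∃ l ∈ c, l.Realize w

variable (M) in
/-- `M ⊨ C`: the universal closure of every clause of `C` holds in `M`. -/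
def ClauseSet.Models (C : ClauseSet L) : Prop := ∀ c ∈ C, ∀ w : ℕ → M, Clause.Realize w c

end Semantics

/-- `C ⊨ D`: every (non-empty) model of `C` is a model of `D`. -/
def ClauseSet.Entails {L : FirstOrder.Language.{u, v}} (C D : ClauseSet L) : Prop :=
  ∀ (M : Type (max u v)) [Nonempty M] [L.Structure M], C.Models M → D.Models M

/-- `C ⊨ ⊥`: `C` has no (non-empty) model. -/
def ClauseSet.Unsatisfiable {L : FirstOrder.Language.{u, v}} (C : ClauseSet L) : Prop :=
  ∀ (M : Type (max u v)) [Nonempty M] [L.Structure M], ¬ C.Models M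

/-! ### The constant `η`, zero and successor -/

/-- The language `L ∪ {η}`. -/
abbrev WithEta (L : FirstOrder.Language.{u, v}) : FirstOrder.Language.{u, v} := L[[Unit]]

/-- Languages with a distinguished constant symbol `0` and unary function symbol `s`. -/
class HasZeroSucc (L : FirstOrder.Language.{u, v}) where
  zero : L.Functions 0
  succ : L.Functions 1

/-- The term `0`. -/
def zeroT {L : FirstOrder.Language.{u, v}} [HasZeroSucc L] {α : Type*} : L.Term α :=
  Constants.term (HasZeroSucc.zero : L.Functions 0)

/-- The term `s(t)`. -/
def succT {L : FirstOrder.Language.{u, v}} [HasZeroSucc L] {α : Type*} (t : L.Term α) : L.Term α :=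
  Functions.apply₁ HasZeroSucc.succ t

/-- `L ∪ {η}` inherits `0` and `s` from `L`. -/
instance {L : FirstOrder.Language.{u, v}} [HasZeroSucc L] : HasZeroSucc (WithEta L) where
  zero := (L.lhomWithConstants Unit).onFunction HasZeroSucc.zero
  succ := (L.lhomWithConstants Unit).onFunction HasZeroSucc.succ

/-- The constant `η` as a term of `L ∪ {η}`. -/
def etaT {L : FirstOrder.Language.{u, v}} {α : Type*} : (WithEta L).Term α := Constants.term (L.con ())

section SubstEta

variable {L : FirstOrder.Language.{u, v}}

/-- `u(t)`: replace every occurrence of `η` in the term `u = u(η)` by `t`. -/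
def substEtaTerm (t : (WithEta L).Term ℕ) (u : (WithEta L).Term ℕ) : (WithEta L).Term ℕ :=
  ((L.lhomWithConstants Unit).onTerm u.constantsToVars).subst (Sum.elim (fun _ => t) Term.var)

/-- Replace every occurrence of `η` in an atom by `t`. -/
def Atom.substEta (t : (WithEta L).Term ℕ) : Atom (WithEta L) → Atom (WithEta L)
  | .eq t₁ t₂ => .eq (substEtaTerm t t₁) (substEtaTerm t t₂)
  | .rel R ts => .rel R fun i => substEtaTerm t (ts i)

/-- Replace every occurrence of `η` in a literal by `t`. -/
def Literal.substEta (t : (WithEta L).Term ℕ) : Literal (WithEta L) → Literal (WithEta L)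
  | .pos a => .pos (a.substEta t)
  | .neg a => .neg (a.substEta t)

open Classical in
/-- Replace every occurrence of `η` in a clause by `t`. -/
noncomputable def Clause.substEta (t : (WithEta L).Term ℕ) (c : Clause (WithEta L)) :
    Clause (WithEta L) :=
  c.image (Literal.substEta t)

/-- `C(t)`: replace every occurrence of `η` in the clause set `C = C(η)` by `t`. -/
def ClauseSet.substEta (t : (WithEta L).Term ℕ) (C : ClauseSet (WithEta L)) :
    ClauseSet (WithEta L) :=
  Clause.substEta t '' C

end SubstEta

/-! ### Clause set cycles -/

/-- A finite `L ∪ {η}` clause set `C(η)` is an `L` clause set cycle if `C(s(η)) ⊨ C(η)` and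
`C(0) ⊨ ⊥`. -/
structure IsClauseSetCycle (L : FirstOrder.Language.{u, v}) [HasZeroSucc L]
    (C : ClauseSet (WithEta L)) : Prop where
  finite : C.Finite
  step : (C.substEta (succT etaT)).Entails C
  base : (C.substEta zeroT).Unsatisfiable

/-- `D(η)` is refuted by some `L` clause set cycle `C(η)`, that is, `D(η) ⊨ C(η)`. -/
def RefutedByCycle (L : FirstOrder.Language.{u, v}) [HasZeroSucc L] (D : ClauseSet (WithEta L)) : Prop :=
  ∃ C : ClauseSet (WithEta L), IsClauseSetCycle L C ∧ D.Entails C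

/-! ### Induction -/

section Induction

variable {L : FirstOrder.Language.{u, v}} [HasZeroSucc L]

/-- The universal closure of `φ(0, z) ∧ ∀ x, (φ(x, z) → φ(s(x), z)) → ∀ x, φ(x, z)`. The
parameters `z` are the variables `Sum.inl i`, the induction variable `x` is `Sum.inr ()`. -/
noncomputable def inductionAxiom {n : ℕ} (φ : L.Formula (Fin n ⊕ Unit)) : L.Sentence :=
  let φ0 : L.Formula (Fin n) := φ.subst (Sum.elim Term.var fun _ => zeroT)
  let φs : L.Formula (Fin n ⊕ Unit) :=
    φ.subst (Sum.elim (fun i => Term.var (Sum.inl i)) fun _ => succT (Term.var (Sum.inr ())))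
  let ax : L.Formula (Fin n) := (φ0 ⊓ Formula.iAlls Unit (φ.imp φs)).imp (Formula.iAlls Unit φ)
  Formula.iAlls (Fin n) (ax.relabel (Sum.inr : Fin n → Empty ⊕ Fin n))

variable (L) in
/-- The theory of open induction: induction for all quantifier-free `L` formulas, with
parameters. -/
def openInduction : L.Theory :=
  {σ | ∃ (n : ℕ) (φ : L.Formula (Fin n ⊕ Unit)), BoundedFormula.IsQF φ ∧ σ = inductionAxiom φ}

end Induction

/-- The union of the `L` theory `T` and the `L ∪ {η}` clause set `D` has no (non-empty) model. -/
def InconsistentWith {L : FirstOrder.Language.{u, v}} (T : L.Theory) (D : ClauseSet (WithEta L)) : Prop :=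
  ∀ (M : Type (max u v)) [Nonempty M] [(WithEta L).Structure M],
    ¬ (M ⊨ (L.lhomWithConstants Unit).onTheory T ∧ D.Models M)

/-! ### Clausification -/

/-- `cls` assigns to every `∀₁` sentence a logically equivalent clause set. -/
def IsClausification {L : FirstOrder.Language.{u, v}} (cls : L.Sentence → ClauseSet L) : Prop :=
  ∀ σ : L.Sentence, BoundedFormula.IsUniversal σ →
    ∀ (M : Type (max u v)) [Nonempty M] [L.Structure M], (cls σ).Models M ↔ M ⊨ σ

/-- `cls(Γ)`, the union of the sets `cls(γ)` for `γ ∈ Γ`. -/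
def clsTheory {L : FirstOrder.Language.{u, v}} (cls : L.Sentence → ClauseSet L) (T : L.Theory) :
    ClauseSet L :=
  ⋃ σ ∈ T, cls σ

section Existence

variable {L : FirstOrder.Language.{u, v}}

/-- The variable with index `i` among the bound ones is renamed to the variable `i`. -/
def boundToNat {n : ℕ} (t : L.Term (Empty ⊕ Fin n)) : L.Term ℕ :=
  t.relabel (Sum.elim Empty.elim Fin.val)

theorem realize_boundToNat {n : ℕ} (t : L.Term (Empty ⊕ Fin n)) {M : Type*} [L.Structure M]
    (w : ℕ → M) :
    (boundToNat t).realize w = t.realize (Sum.elim default fun i : Fin n => w i) := by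
  unfold boundToNat
  rw [Term.realize_relabel]
  congr 1
  funext x
  rcases x with x | x
  · exact x.elim
  · rfl

open Classical in
theorem exists_cnf {n : ℕ} {φ : L.BoundedFormula Empty n} (h : φ.IsQF) :
    (∃ C : ClauseSet L, ∀ (M : Type (max u v)) [L.Structure M] (w : ℕ → M),
      (∀ c ∈ C, Clause.Realize w c) ↔ φ.Realize default fun i : Fin n => w i) ∧
    (∃ C : ClauseSet L, ∀ (M : Type (max u v)) [L.Structure M] (w : ℕ → M),
      (∀ c ∈ C, Clause.Realize w c) ↔ ¬ φ.Realize default fun i : Fin n => w i) := by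
  induction h with
  | falsum =>
    refine ⟨⟨{∅}, ?_⟩, ⟨∅, ?_⟩⟩ <;> intro M _ w <;> simp [Clause.Realize, BoundedFormula.Realize]
  | of_isAtomic h =>
    cases h with
    | equal t₁ t₂ =>
      refine ⟨⟨{{.pos (.eq (boundToNat t₁) (boundToNat t₂))}}, ?_⟩,
        ⟨{{.neg (.eq (boundToNat t₁) (boundToNat t₂))}}, ?_⟩⟩ <;> intro M _ w <;>
        simp [Clause.Realize, Literal.Realize, Atom.Realize, realize_boundToNat]
    | rel R ts =>
      refine ⟨⟨{{.pos (.rel R fun i => boundToNat (ts i))}}, ?_⟩,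
        ⟨{{.neg (.rel R fun i => boundToNat (ts i))}}, ?_⟩⟩ <;> intro M _ w <;>
        simp [Clause.Realize, Literal.Realize, Atom.Realize, realize_boundToNat,
          BoundedFormula.realize_rel]
  | imp _ _ ih₁ ih₂ =>
    obtain ⟨⟨P, hP⟩, ⟨P', hP'⟩⟩ := ih₁
    obtain ⟨⟨Q, hQ⟩, ⟨Q', hQ'⟩⟩ := ih₂
    refine ⟨⟨{e | ∃ c ∈ P', ∃ d ∈ Q, e = c ∪ d}, ?_⟩, ⟨P ∪ Q', ?_⟩⟩
    · intro M _ w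
      rw [BoundedFormula.realize_imp, ← hQ M w, ← not_imp_not, ← hP' M w]
      have key : ∀ c d : Clause L, Clause.Realize w (c ∪ d) ↔
          (Clause.Realize w c ∨ Clause.Realize w d) := by
        intro c d
        simp only [Clause.Realize, Finset.mem_union, or_and_right, exists_or]
      constructor
      · intro h hn c hc
        by_contra hcc
        refine hn fun d hd => ?_
        exact ((key c d).1 (h _ ⟨c, hc, d, hd, rfl⟩)).resolve_left hcc
      · rintro h _ ⟨c, hc, d, hd, rfl⟩
        rw [key]
        by_cases hq : ∀ d ∈ Q, Clause.Realize w d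
        · exact Or.inr (hq d hd)
        · exact Or.inl (h hq c hc)
    · intro M _ w
      rw [BoundedFormula.realize_imp, Classical.not_imp, ← hP M w, ← hQ' M w]
      simp only [Set.mem_union, or_imp, forall_and]

theorem exists_clauseSet {n : ℕ} {φ : L.BoundedFormula Empty n} (h : φ.IsUniversal) :
    ∃ C : ClauseSet L, ∀ (M : Type (max u v)) [Nonempty M] [L.Structure M],
      C.Models M ↔ ∀ xs : Fin n → M, φ.Realize default xs := by
  induction h with
  | @of_isQF n φ h =>
    obtain ⟨C, hC⟩ := (exists_cnf h).1
    refine ⟨C, fun M _ _ => ?_⟩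
    constructor
    · intro hM xs
      obtain ⟨a⟩ := ‹Nonempty M›
      have := (hC M fun i => if h : i < n then xs ⟨i, h⟩ else a).1 fun c hc => hM c hc _
      simpa using this
    · intro hM c hc w
      exact (hC M w).2 (hM _) c hc
  | all _ ih =>
    obtain ⟨C, hC⟩ := ih
    refine ⟨C, fun M _ _ => ?_⟩
    rw [hC M]
    constructor
    · intro h xs
      rw [BoundedFormula.realize_all]
      exact fun a => h _
    · intro h xs
      have := BoundedFormula.realize_all.1 (h (Fin.init xs)) (xs (Fin.last _))
      rwa [Fin.snoc_init_self] at this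

/-- Clausifications exist. -/
theorem exists_isClausification (L : FirstOrder.Language.{u, v}) :
    ∃ cls : L.Sentence → ClauseSet L, IsClausification cls := by
  classical
  refine ⟨fun σ => if h : BoundedFormula.IsUniversal σ then (exists_clauseSet h).choose else ∅,
    fun σ h M _ _ => ?_⟩
  simp only [dif_pos h]
  rw [(exists_clauseSet h).choose_spec M]
  constructor
  · intro H
    exact H default
  · intro H xs
    rw [Subsingleton.elim xs default]
    exact H

end Existence

/-! ### Linear arithmetic -/

/-- The function symbols `0`, `s`, `p`, `+`. -/
inductive LAFunc : ℕ → Type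
  | zero : LAFunc 0
  | succ : LAFunc 1
  | pred : LAFunc 1
  | add : LAFunc 2

/-- The language `{0, s, p, +}` of linear arithmetic. -/
def LA : FirstOrder.Language.{0, 0} := ⟨LAFunc, fun _ => Empty⟩

instance : HasZeroSucc LA := ⟨LAFunc.zero, LAFunc.succ⟩

section LATerms

variable {α : Type}

/-- The term `p(t)`. -/
def predT (t : LA.Term α) : LA.Term α := Functions.apply₁ (L := LA) LAFunc.pred t

/-- The term `t + u`. -/
def addT (t u : LA.Term α) : LA.Term α := Functions.apply₂ (L := LA) LAFunc.add t u

/-- The numeral `s(⋯s(0)⋯)` with `k` occurrences of `s`. -/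
def numeral : ℕ → LA.Term α
  | 0 => zeroT
  | k + 1 => succT (numeral k)

/-- `n · t`, where `0 · t = 0` and `(i + 1) · t = t + (i · t)`. -/
def mulT : ℕ → LA.Term α → LA.Term α
  | 0, _ => zeroT
  | i + 1, t => addT t (mulT i t)

end LATerms

/-- `s(0) ≠ 0`. -/
def axA1 : LA.Sentence := ∼(succT zeroT =' zeroT)

/-- `p(0) = 0`. -/
def axA2 : LA.Sentence := predT zeroT =' zeroT

/-- `p(s(x)) = x`. -/
def axA3 : LA.Sentence := ∀' (predT (succT (&0)) =' &0)

/-- `x + 0 = x`. -/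
def axA4 : LA.Sentence := ∀' (addT (&0) zeroT =' &0)

/-- `x + s(y) = s(x + y)`. -/
def axA5 : LA.Sentence := ∀' ∀' (addT (&0) (succT (&1)) =' succT (addT (&0) (&1)))

/-- `x + y = y + x`. -/
def axB2 : LA.Sentence := ∀' ∀' (addT (&0) (&1) =' addT (&1) (&0))

/-- `x + (y + z) = (x + y) + z`. -/
def axB3 : LA.Sentence :=
  ∀' ∀' ∀' (addT (&0) (addT (&1) (&2)) =' addT (addT (&0) (&1)) (&2))

/-- The base theory `B`. -/
def theoryB : LA.Theory := {axA1, axA2, axA3, axA4, axA5}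

/-- The formula `n · x + (m - n)k = m · x → x = k`, with the single free variable `x`; here
`(m - n)k` and `k` are numerals. It is only used for `0 < n < m`. -/
def formulaE (k n m : ℕ) : LA.Formula Unit :=
  (Term.equal (addT (mulT n (Term.var ())) (numeral ((m - n) * k))) (mulT m (Term.var ()))).imp
    (Term.equal (Term.var ()) (numeral k))

/-- `φ(η)`: replace the free variable `x` of the `L` formula `φ(x)` by `η`. -/
def atEta {L : FirstOrder.Language.{u, v}} (φ : L.Formula Unit) : (WithEta L).Sentence :=
  ((L.lhomWithConstants Unit).onFormula φ).subst fun _ => etaT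

/-- The clause set `cls(B + B2 + B3 + ¬E(η))`, where `E` is `formulaE k n m`. -/
def clauseSetE (cls : (WithEta LA).Sentence → ClauseSet (WithEta LA)) (k n m : ℕ) :
    ClauseSet (WithEta LA) :=
  clsTheory cls
    ((LA.lhomWithConstants Unit).onTheory (theoryB ∪ {axB2, axB3}) ∪ {∼(atEta (formulaE k n m))})

end CSC

/-! Unsatisfiability: open induction yields left cancellation for `+` and the dichotomy "zero or a
successor". Cancelling `n · x` leaves `(m - n)k = (m - n) · x`, and a nonzero element has no zero
positive multiple, so `x = k` (`eq_nsmul_of_nsmul_add_eq`).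

Non-refutability: a cycle holding at `s^i(a)` holds at `a`, and it never holds at `0`. Hence it
fails at every natural number. Finiteness of the cycle and an ultrafilter give one clause `d` that
fails at almost every `N` under suitable assignments.

For each `j`, take the ultrapower of `ℕ` and identify sequences lying almost above the identity when
they differ by a fixed integer multiple of `N + j`. Negative literals of `d` stay false at the class
of the identity. A positive one can become true for at most one `j`, because `r(N + i) = s(N + j) ≠
0` for almost all `N` forces `i = j` (`SeqRel.modulus_unique`). As `d` is finite, some `j` keeps it
false. But at the class of `N + j + k` the two sides of the premise of `E` differ by `(m - n)(N +
j)`, so `E` fails there. If the clause set entailed the cycle, the cycle would hold there, and so,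
`j + k` steps down, at the class of the identity: a contradiction. -/

namespace CSC

open FirstOrder FirstOrder.Language Filter

universe u v

/-! ### Semantics of the terms `0`, `s(t)` and `η` -/

section ZeroSucc

variable {L : FirstOrder.Language.{u, v}} [HasZeroSucc L] (M : Type*) [L.Structure M]

/-- The value of `0`. -/
def zeroV : M := ((HasZeroSucc.zero : L.Constants) : M)

variable {M} in
/-- The value of `s` at `x`. -/
def succV (x : M) : M := Structure.funMap (HasZeroSucc.succ : L.Functions 1) ![x]

variable {M} {α : Type*} (w : α → M)

@[simp] theorem realize_zeroT : (zeroT : L.Term α).realize w = zeroV (L := L) M :=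
  Term.realize_constants

@[simp] theorem realize_succT (t : L.Term α) :
    (succT t).realize w = succV (L := L) (t.realize w) :=
  Term.realize_functions_apply₁

end ZeroSucc

section Eta

variable {L : FirstOrder.Language.{u, v}} {M : Type*}

/-- The expansion of an `L` structure by the value `a` of `η`. -/
abbrev etaStructure (L : FirstOrder.Language.{u, v}) {M : Type*} [L.Structure M] (a : M) :
    (WithEta L).Structure M :=
  @Language.withConstantsStructure L M _ Unit (constantsOn.structure fun _ => a)

/-- `(M, a) ⊨ C(η)`. -/
def ClauseSet.ModelsAt [L.Structure M] (C : ClauseSet (WithEta L)) (a : M) : Prop :=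
  @ClauseSet.Models (WithEta L) M (etaStructure L a) C

/-- The value of a term of `L ∪ {η}` in `(M, a)`. -/
def evalAt [L.Structure M] (a : M) (w : ℕ → M) (t : (WithEta L).Term ℕ) : M :=
  @Term.realize (WithEta L) M (etaStructure L a) ℕ w t

/-- Substitution lemma: both sides evaluate the same term in which `η` has been turned into a
variable. Structures are passed explicitly because one carrier is read at two values of `η`. -/
theorem evalAt_substEtaTerm [L.Structure M] (a b : M) (w : ℕ → M) (t u : (WithEta L).Term ℕ)
    (hb : evalAt a w t = b) : evalAt a w (substEtaTerm t u) = evalAt b w u := by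
  subst hb
  have key : ∀ c : M, evalAt c w u = u.constantsToVars.realize (Sum.elim (fun _ => c) w) := by
    intro c
    let : (constantsOn Unit).Structure M := constantsOn.structure fun _ => c
    exact (Term.realize_constantsToVars (t := u) (v := w)).symm
  rw [key]
  unfold substEtaTerm
  let : (constantsOn Unit).Structure M := constantsOn.structure fun _ => a
  change Term.realize w _ = _
  rw [Term.realize_subst, LHom.realize_onTerm]
  congr 1
  funext x
  rcases x with x | x <;> rfl

theorem Literal.realize_substEta [L.Structure M] (a b : M) (w : ℕ → M) (t : (WithEta L).Term ℕ)
    (hb : evalAt a w t = b) (l : Literal (WithEta L)) :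
    @Literal.Realize _ M (etaStructure L a) w (l.substEta t) ↔
      @Literal.Realize _ M (etaStructure L b) w l := by
  have hA : ∀ A : Atom (WithEta L), @Atom.Realize _ M (etaStructure L a) w (A.substEta t) ↔
      @Atom.Realize _ M (etaStructure L b) w A := by
    rintro (⟨t₁, t₂⟩ | ⟨R, ts⟩)
    · have h₁ := evalAt_substEtaTerm a b w t t₁ hb
      have h₂ := evalAt_substEtaTerm a b w t t₂ hb
      exact (congrArg₂ Eq h₁ h₂).to_iff
    · have h : (fun i => evalAt a w (substEtaTerm t (ts i))) = fun i => evalAt b w (ts i) :=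
        funext fun i => evalAt_substEtaTerm a b w t (ts i) hb
      change @Structure.RelMap _ M (etaStructure L a) _ R
        (fun i => evalAt a w (substEtaTerm t (ts i))) ↔
          @Structure.RelMap _ M (etaStructure L b) _ R (fun i => evalAt b w (ts i))
      rw [h]
      rcases R with R | R
      · rfl
      · exact isEmptyElim R
  cases l with
  | pos A => exact hA A
  | neg A => exact not_congr (hA A)

/-- The value of `t` must not depend on the assignment, since the variables of a clause are
universally quantified. The uses are `t = s(η)` and `t = 0`. -/
theorem ClauseSet.modelsAt_substEta [L.Structure M] (a b : M) (t : (WithEta L).Term ℕ)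
    (hb : ∀ w, evalAt a w t = b) (C : ClauseSet (WithEta L)) :
    (C.substEta t).ModelsAt a ↔ C.ModelsAt b := by
  classical
  simp only [ModelsAt, Models, ClauseSet.substEta, Set.forall_mem_image, Clause.Realize,
    Clause.substEta, Finset.mem_image, exists_exists_and_eq_and]
  refine forall₃_congr fun c _ w => ?_
  simp only [Literal.realize_substEta a b w t (hb w)]

end Eta

/-! ### Descent along a clause set cycle -/

section Cycle

variable {L : FirstOrder.Language.{u, v}} [HasZeroSucc L] {C : ClauseSet (WithEta L)}
  {M : Type (max u v)} [L.Structure M]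

theorem IsClauseSetCycle.modelsAt_of_succ (hC : IsClauseSetCycle L C) (a : M)
    (h : C.ModelsAt (succV (L := L) a)) : C.ModelsAt a := by
  have : Nonempty M := ⟨a⟩
  let := etaStructure L a
  refine hC.step M ?_
  refine (ClauseSet.modelsAt_substEta a _ _ (fun w => ?_) C).2 h
  change Term.realize w _ = _
  rw [realize_succT]
  rfl

theorem IsClauseSetCycle.not_modelsAt_zero (hC : IsClauseSetCycle L C) :
    ¬ C.ModelsAt (zeroV (L := L) M) := by
  intro h
  have : Nonempty M := ⟨zeroV (L := L) M⟩
  let := etaStructure L (zeroV (L := L) M)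
  refine hC.base M ?_
  refine (ClauseSet.modelsAt_substEta (zeroV (L := L) M) _ _ (fun w => ?_) C).2 h
  change Term.realize w _ = _
  rw [realize_zeroT]
  rfl

theorem IsClauseSetCycle.modelsAt_of_iterate_succ (hC : IsClauseSetCycle L C) (a : M) (j : ℕ)
    (h : C.ModelsAt ((succV (L := L))^[j] a)) : C.ModelsAt a := by
  induction j with
  | zero => exact h
  | succ j ih =>
    rw [Function.iterate_succ_apply'] at h
    exact ih (hC.modelsAt_of_succ _ h)

end Cycle

/-! ### Realization of the induction axioms -/

theorem realize_inductionAxiom {L : FirstOrder.Language.{u, v}} [HasZeroSucc L] {M : Type*}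
    [L.Structure M] {n : ℕ} (φ : L.Formula (Fin n ⊕ Unit)) :
    M ⊨ inductionAxiom φ ↔ ∀ z : Fin n → M,
      φ.Realize (Sum.elim z fun _ => zeroV (L := L) M) →
      (∀ x : M, φ.Realize (Sum.elim z fun _ => x) →
        φ.Realize (Sum.elim z fun _ => succV (L := L) x)) →
      ∀ x : M, φ.Realize (Sum.elim z fun _ => x) := by
  have hsub : ∀ (β : Type) (f : Fin n ⊕ Unit → L.Term β) (v : β → M),
      Formula.Realize (φ.subst f : L.Formula β) v ↔ φ.Realize fun x => (f x).realize v :=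
    fun β f v => BoundedFormula.realize_subst
  -- The induction variable is quantified as a function on `Unit`; this turns it into a point of
  -- `M`.
  have hun : ∀ p : (Unit → M) → Prop, (∀ i, p i) ↔ ∀ x : M, p fun _ => x :=
    fun p => ⟨fun h x => h _, fun h i => h (i ())⟩
  unfold inductionAxiom Sentence.Realize
  simp only [Formula.realize_iAlls, Formula.realize_relabel, Formula.realize_imp,
    Formula.realize_inf, hsub, hun, and_imp]
  refine forall_congr' fun z => ?_
  refine imp_congr (iff_of_eq (congrArg φ.Realize ?_)) (imp_congr (forall_congr' fun x =>
    imp_congr Iff.rfl (iff_of_eq (congrArg φ.Realize ?_))) Iff.rfl) <;>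
  · funext y
    rcases y with y | y
    · rfl
    · simp

/-! ### Semantics of linear arithmetic -/

section LASemantics

variable {M : Type*} [LA.Structure M]

/-- The value of `p` at `x`. -/
def predV (x : M) : M := Structure.funMap (L := LA) LAFunc.pred ![x]

/-- The value of `+` at `x` and `y`. -/
def addV (x y : M) : M := Structure.funMap (L := LA) LAFunc.add ![x, y]

/-- The value of `n · x`. -/
def mulV : ℕ → M → M
  | 0, _ => zeroV (L := LA) M
  | i + 1, x => addV x (mulV i x)

variable (M) in
/-- The value of the numeral of `k`. -/
def numV (k : ℕ) : M := (succV (L := LA))^[k] (zeroV (L := LA) M)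

variable {α : Type} (w : α → M)

@[simp] theorem realize_predT (t : LA.Term α) : (predT t).realize w = predV (t.realize w) :=
  Term.realize_functions_apply₁

@[simp] theorem realize_addT (t u : LA.Term α) :
    (addT t u).realize w = addV (t.realize w) (u.realize w) :=
  Term.realize_functions_apply₂

@[simp] theorem realize_mulT (n : ℕ) (t : LA.Term α) :
    (mulT n t).realize w = mulV n (t.realize w) := by
  induction n with
  | zero => exact realize_zeroT w
  | succ n ih => rw [mulT, realize_addT, ih, mulV]

@[simp] theorem realize_numeral (k : ℕ) :
    (numeral k : LA.Term α).realize w = numV M k := by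
  induction k with
  | zero => exact realize_zeroT w
  | succ k ih => rw [numeral, realize_succT, ih, numV, numV, Function.iterate_succ_apply']

end LASemantics

/-- The axioms of `B + B2 + B3` hold in `M`. -/
structure IsArithmetic (M : Type*) [LA.Structure M] : Prop where
  one_ne_zero : succV (L := LA) (zeroV (L := LA) M) ≠ zeroV (L := LA) M
  pred_zero : predV (zeroV (L := LA) M) = zeroV (L := LA) M
  pred_succ (x : M) : predV (succV (L := LA) x) = x
  add_zero (x : M) : addV x (zeroV (L := LA) M) = x
  add_succ (x y : M) : addV x (succV (L := LA) y) = succV (L := LA) (addV x y)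
  add_comm (x y : M) : addV x y = addV y x
  add_assoc (x y z : M) : addV x (addV y z) = addV (addV x y) z

theorem models_arithmetic_iff (M : Type*) [LA.Structure M] :
    M ⊨ theoryB ∪ {axB2, axB3} ↔ IsArithmetic M := by
  have h : M ⊨ theoryB ∪ {axB2, axB3} ↔
      ((M ⊨ axA1 ∧ M ⊨ axA2 ∧ M ⊨ axA3 ∧ M ⊨ axA4 ∧ M ⊨ axA5) ∧ M ⊨ axB2 ∧ M ⊨ axB3) := by
    simp only [theoryB, Theory.model_iff, Set.mem_union, Set.mem_insert_iff,
      Set.mem_singleton_iff, or_imp, forall_and, forall_eq]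
  rw [h]
  have h1 : M ⊨ axA1 ↔ succV (L := LA) (zeroV (L := LA) M) ≠ zeroV (L := LA) M := by
    simp [axA1, Sentence.Realize, Formula.Realize, BoundedFormula.realize_not]
  have h2 : M ⊨ axA2 ↔ predV (zeroV (L := LA) M) = zeroV (L := LA) M := by
    simp [axA2, Sentence.Realize, Formula.Realize]
  have h3 : M ⊨ axA3 ↔ ∀ x : M, predV (succV (L := LA) x) = x := by
    simp [axA3, Sentence.Realize, Formula.Realize, Fin.snoc]
  have h4 : M ⊨ axA4 ↔ ∀ x : M, addV x (zeroV (L := LA) M) = x := by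
    simp [axA4, Sentence.Realize, Formula.Realize, Fin.snoc]
  have h5 : M ⊨ axA5 ↔ ∀ x y : M, addV x (succV (L := LA) y) = succV (L := LA) (addV x y) := by
    simp [axA5, Sentence.Realize, Formula.Realize, Fin.snoc]
  have h6 : M ⊨ axB2 ↔ ∀ x y : M, addV x y = addV y x := by
    simp [axB2, Sentence.Realize, Formula.Realize, Fin.snoc]
  have h7 : M ⊨ axB3 ↔ ∀ x y z : M, addV x (addV y z) = addV (addV x y) z := by
    simp [axB3, Sentence.Realize, Formula.Realize, Fin.snoc]
  rw [h1, h2, h3, h4, h5, h6, h7]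
  exact ⟨fun ⟨⟨a, b, c, d, e⟩, f, g⟩ => ⟨a, b, c, d, e, f, g⟩,
    fun ⟨a, b, c, d, e, f, g⟩ => ⟨⟨a, b, c, d, e⟩, f, g⟩⟩

theorem realize_formulaE {M : Type*} [LA.Structure M] (k n m : ℕ) (a : M) :
    (formulaE k n m).Realize (fun _ => a) ↔
      (addV (mulV n a) (numV M ((m - n) * k)) = mulV m a → a = numV M k) := by
  simp [formulaE, Formula.realize_imp, Formula.realize_equal]

/-! ### Universality of the sentences to be clausified -/

section Universal

variable {L L' : FirstOrder.Language} {α β : Type*} {n : ℕ}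

theorem isQF_onBoundedFormula (g : L →ᴸ L') {φ : L.BoundedFormula α n} (h : φ.IsQF) :
    (g.onBoundedFormula φ).IsQF := by
  induction h with
  | falsum => exact .falsum
  | of_isAtomic h =>
    cases h with
    | equal t₁ t₂ => exact (BoundedFormula.IsAtomic.equal _ _).isQF
    | rel R ts => exact (BoundedFormula.IsAtomic.rel _ _).isQF
  | imp _ _ h₁ h₂ => exact h₁.imp h₂

theorem isUniversal_onBoundedFormula (g : L →ᴸ L') {φ : L.BoundedFormula α n}
    (h : φ.IsUniversal) : (g.onBoundedFormula φ).IsUniversal := by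
  induction h with
  | of_isQF h => exact .of_isQF (isQF_onBoundedFormula g h)
  | all _ ih => exact ih.all

theorem isQF_subst (f : α → L.Term β) {φ : L.BoundedFormula α n} (h : φ.IsQF) :
    (φ.subst f).IsQF := by
  induction h with
  | falsum => exact .falsum
  | of_isAtomic h =>
    cases h with
    | equal t₁ t₂ => exact (BoundedFormula.IsAtomic.equal _ _).isQF
    | rel R ts => exact (BoundedFormula.IsAtomic.rel _ _).isQF
  | imp _ _ h₁ h₂ => exact h₁.imp h₂

theorem isUniversal_of_mem_arithmetic {σ : LA.Sentence} (h : σ ∈ theoryB ∪ {axB2, axB3}) :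
    BoundedFormula.IsUniversal σ := by
  have hq : ∀ {j : ℕ} (t u : LA.Term (Empty ⊕ Fin j)),
      (t.bdEqual u : LA.BoundedFormula Empty j).IsQF :=
    fun t u => (BoundedFormula.IsAtomic.equal t u).isQF
  simp only [theoryB, Set.mem_union, Set.mem_insert_iff, Set.mem_singleton_iff] at h
  rcases h with (rfl | rfl | rfl | rfl | rfl) | rfl | rfl
  · exact (hq _ _).not.isUniversal
  · exact (hq _ _).isUniversal
  · exact (hq _ _).isUniversal.all
  · exact (hq _ _).isUniversal.all
  · exact (hq _ _).isUniversal.all.all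
  · exact (hq _ _).isUniversal.all.all
  · exact (hq _ _).isUniversal.all.all.all

theorem isQF_formulaE (k n m : ℕ) : BoundedFormula.IsQF (formulaE k n m) :=
  (BoundedFormula.IsAtomic.equal _ _).isQF.imp (BoundedFormula.IsAtomic.equal _ _).isQF

end Universal

theorem realize_atEta {L : FirstOrder.Language} {M : Type*} [L.Structure M]
    [(WithEta L).Structure M] [(L.lhomWithConstants Unit).IsExpansionOn M] (φ : L.Formula Unit) :
    M ⊨ atEta φ ↔ φ.Realize fun _ => ((L.con () : (WithEta L).Constants) : M) := by
  unfold atEta Sentence.Realize Formula.Realize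
  rw [BoundedFormula.realize_subst]
  simp only [etaT, Term.realize_constants]
  exact LHom.realize_onFormula _ φ

/-- Eliminates `cls`: all sentences involved are universal, so the clausification preserves their
models and only semantics matters afterwards. -/
theorem clauseSetE_models_iff {cls : (WithEta LA).Sentence → ClauseSet (WithEta LA)}
    (hcls : IsClausification cls) (k n m : ℕ) (M : Type) [Nonempty M] [LA.Structure M]
    [(WithEta LA).Structure M] [(LA.lhomWithConstants Unit).IsExpansionOn M] :
    (clauseSetE cls k n m).Models M ↔ IsArithmetic M ∧
      ¬ (formulaE k n m).Realize fun _ : Unit => ((LA.con () : (WithEta LA).Constants) : M) := by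
  have h : ∀ T : (WithEta LA).Theory, (∀ σ ∈ T, BoundedFormula.IsUniversal σ) →
      ((clsTheory cls T).Models M ↔ M ⊨ T) := by
    intro T hT
    rw [Theory.model_iff]
    simp only [clsTheory, ClauseSet.Models, Set.mem_iUnion]
    constructor
    · intro H σ hσ
      exact (hcls σ (hT σ hσ) M).1 fun c hc w => H c ⟨σ, hσ, hc⟩ w
    · rintro H c ⟨σ, hσ, hc⟩ w
      exact (hcls σ (hT σ hσ) M).2 (H σ hσ) c hc w
  rw [clauseSetE, h, Theory.model_union_iff, LHom.onTheory_model, models_arithmetic_iff,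
    Theory.model_singleton_iff, Sentence.realize_not, realize_atEta]
  rintro σ (⟨τ, hτ, rfl⟩ | rfl)
  · exact isUniversal_onBoundedFormula _ (isUniversal_of_mem_arithmetic hτ)
  · exact (isQF_subst _ (isQF_onBoundedFormula _ (isQF_formulaE k n m))).not.isUniversal

/-! ### Open induction refutes `¬ E(η)` -/

/-- The additive monoid of a model of `B + B2 + B3`. -/
@[reducible] def IsArithmetic.addCommMonoid {M : Type*} [LA.Structure M] (h : IsArithmetic M) :
    AddCommMonoid M where
  add := addV
  zero := zeroV (L := LA) M
  add_assoc x y z := (h.add_assoc x y z).symm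
  add_comm := h.add_comm
  zero_add x := (h.add_comm _ _).trans (h.add_zero x)
  add_zero := h.add_zero
  nsmul := @nsmulRec M ⟨zeroV (L := LA) M⟩ ⟨addV⟩
  nsmul_zero _ := rfl
  nsmul_succ _ _ := rfl

theorem IsArithmetic.succV_eq {M : Type*} [LA.Structure M] (h : IsArithmetic M) (x : M) :
    succV (L := LA) x = addV x (succV (L := LA) (zeroV (L := LA) M)) := by
  rw [h.add_succ, h.add_zero]

theorem IsArithmetic.mulV_eq {M : Type*} [LA.Structure M] (h : IsArithmetic M) (n : ℕ) (x : M) :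
    let := h.addCommMonoid
    mulV n x = n • x := by
  intro
  induction n with
  | zero => exact (zero_nsmul x).symm
  | succ n ih => rw [succ_nsmul', ← ih]; rfl

theorem IsArithmetic.numV_eq {M : Type*} [LA.Structure M] (h : IsArithmetic M) (k : ℕ) :
    let := h.addCommMonoid
    numV M k = k • succV (L := LA) (zeroV (L := LA) M) := by
  intro
  induction k with
  | zero => exact (zero_nsmul _).symm
  | succ k ih =>
    rw [succ_nsmul, ← ih, numV, Function.iterate_succ_apply', h.succV_eq]
    rfl

/-- In a cancellative commutative monoid in which every non-zero element is a successor, the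
equation `n • a + (m - n) * k = m • a` determines `a`. -/
theorem eq_nsmul_of_nsmul_add_eq {M : Type*} [AddCommMonoid M] (one : M) (p : M → M)
    (hsucc : ∀ x : M, x + one ≠ 0) (hpred : ∀ x : M, x = 0 ∨ x = p x + one)
    (hcancel : ∀ x y z : M, x + y = x + z → y = z) {k n m : ℕ} (hnm : n < m) (a : M)
    (h : n • a + ((m - n) * k) • one = m • a) : a = k • one := by
  obtain ⟨d, rfl⟩ := Nat.exists_eq_add_of_lt hnm
  have hd : n + d + 1 - n = d + 1 := by omega
  rw [hd, show n + d + 1 = n + (d + 1) from rfl, add_nsmul] at h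
  replace h := hcancel _ _ _ h
  -- If `z` is a successor, then so is `(d + 1) • z`.
  have hpos : ∀ z : M, (d + 1) • z = 0 → z = 0 := by
    intro z hz
    refine (hpred z).resolve_right fun hzs => hsucc (d • z + p z) ?_
    rw [add_assoc, ← hzs, ← succ_nsmul, hz]
  -- Peeling off `k` successors either stops at a numeral below `k` or leaves a remainder `z`. After
  -- cancellation, the first case makes a positive numeral zero and the second gives `z = 0`.
  have hsplit : ∀ k : ℕ, (∃ j < k, a = j • one) ∨ ∃ z, a = k • one + z := by
    intro k
    induction k with
    | zero => exact Or.inr ⟨a, by rw [zero_nsmul, zero_add]⟩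
    | succ k ih =>
      rcases ih with ⟨j, hj, rfl⟩ | ⟨z, rfl⟩
      · exact Or.inl ⟨j, hj.trans (Nat.lt_succ_self k), rfl⟩
      · rcases hpred z with rfl | hz
        · exact Or.inl ⟨k, Nat.lt_succ_self k, add_zero _⟩
        · refine Or.inr ⟨p z, ?_⟩
          rw [succ_nsmul, add_assoc, add_comm one, ← hz]
  rcases hsplit k with ⟨j, hj, rfl⟩ | ⟨z, rfl⟩
  · obtain ⟨e, rfl⟩ := Nat.exists_eq_add_of_lt hj
    rw [mul_nsmul', add_assoc, add_nsmul one j, nsmul_add] at h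
    have h0 := hcancel _ _ _ (h.trans (add_zero _).symm)
    have h1 := hpos _ h0
    rw [succ_nsmul] at h1
    exact absurd h1 (hsucc _)
  · rw [mul_nsmul', nsmul_add] at h
    rw [hpos z (hcancel _ _ _ (h.symm.trans (add_zero _).symm)), add_zero]

section OpenInduction

variable {M : Type*} [LA.Structure M]

theorem IsArithmetic.eq_zero_or_eq_succV (h : IsArithmetic M) (hI : M ⊨ openInduction LA)
    (x : M) :
    x = zeroV (L := LA) M ∨ x = succV (L := LA) (predV x) := by
  let x' : LA.Term (Fin 0 ⊕ Unit) := Term.var (Sum.inr ())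
  let φ : LA.Formula (Fin 0 ⊕ Unit) := x'.equal zeroT ⊔ x'.equal (succT (predT x'))
  have hφ : BoundedFormula.IsQF φ :=
    (BoundedFormula.IsAtomic.equal _ _).isQF.sup (BoundedFormula.IsAtomic.equal _ _).isQF
  have hr : ∀ (z : Fin 0 → M) (y : M), φ.Realize (Sum.elim z fun _ => y) ↔
      (y = zeroV (L := LA) M ∨ y = succV (L := LA) (predV y)) := by
    intro z y
    simp [φ, x', Formula.realize_sup, Formula.realize_equal]
  have H := (realize_inductionAxiom φ).1 ((Theory.model_iff _).1 hI _ ⟨0, φ, hφ, rfl⟩) default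
  simp only [hr] at H
  exact H (Or.inl trivial) (fun y _ => Or.inr (by rw [h.pred_succ])) x

/-- Induction on the left summand with `y`, `z` as parameters; the step strips an outer `s`, which
is injective because `p` is its left inverse. -/
theorem IsArithmetic.add_left_cancel (h : IsArithmetic M) (hI : M ⊨ openInduction LA)
    (x y z : M) (hxyz : addV x y = addV x z) : y = z := by
  let x' : LA.Term (Fin 2 ⊕ Unit) := Term.var (Sum.inr ())
  let v : Fin 2 → LA.Term (Fin 2 ⊕ Unit) := fun i => Term.var (Sum.inl i)
  let φ : LA.Formula (Fin 2 ⊕ Unit) :=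
    ((addT x' (v 0)).equal (addT x' (v 1))).imp ((v 0).equal (v 1))
  have hφ : BoundedFormula.IsQF φ :=
    (BoundedFormula.IsAtomic.equal _ _).isQF.imp (BoundedFormula.IsAtomic.equal _ _).isQF
  have hr : ∀ x : M, φ.Realize (Sum.elim ![y, z] fun _ => x) ↔
      (addV x y = addV x z → y = z) := by
    intro x
    simp [φ, x', v, Formula.realize_imp, Formula.realize_equal]
  have H := (realize_inductionAxiom φ).1 ((Theory.model_iff _).1 hI _ ⟨2, φ, hφ, rfl⟩) ![y, z]
  simp only [hr] at H
  refine H ?_ (fun u hu hs => hu ?_) x hxyz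
  · rw [h.add_comm, h.add_zero, h.add_comm, h.add_zero]
    exact id
  · rw [h.add_comm, h.add_succ, h.add_comm _ z, h.add_succ] at hs
    rw [h.add_comm, h.add_comm _ z, ← h.pred_succ (addV y u), hs, h.pred_succ]

theorem IsArithmetic.realize_formulaE (h : IsArithmetic M) (hI : M ⊨ openInduction LA)
    {k n m : ℕ} (hnm : n < m) (a : M) :
    (formulaE k n m).Realize fun _ => a := by
  rw [CSC.realize_formulaE]
  let := h.addCommMonoid
  rw [h.mulV_eq, h.mulV_eq, h.numV_eq, h.numV_eq]
  intro heq
  refine eq_nsmul_of_nsmul_add_eq (succV (L := LA) (zeroV (L := LA) M)) predV ?_ ?_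
    (h.add_left_cancel hI) hnm a heq
  · intro x hx
    have hx0 : succV (L := LA) x = zeroV (L := LA) M := (h.succV_eq x).trans hx
    -- Only `s(0) ≠ 0` is an axiom; applying `p` to `s(x) = 0` reduces the general case to it.
    have hx1 : x = zeroV (L := LA) M := by rw [← h.pred_succ x, hx0, h.pred_zero]
    exact h.one_ne_zero (hx1 ▸ hx0)
  · intro x
    refine (h.eq_zero_or_eq_succV hI x).imp_right fun hx => ?_
    exact hx.trans (h.succV_eq _)

end OpenInduction

theorem inconsistentWith_clauseSetE {cls : (WithEta LA).Sentence → ClauseSet (WithEta LA)}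
    (hcls : IsClausification cls) {k n m : ℕ} (hnm : n < m) :
    InconsistentWith (openInduction LA) (clauseSetE cls k n m) := by
  rintro M _ _ ⟨hT, hD⟩
  let := (LA.lhomWithConstants Unit).reduct M
  rw [LHom.onTheory_model] at hT
  rw [clauseSetE_models_iff hcls] at hD
  exact hD.2 (hD.1.realize_formulaE hT hnm _)

/-! ### A non-cancellative model built from sequences of natural numbers -/

theorem eventually_hyperfilter_lt (K : ℕ) : ∀ᶠ N in (hyperfilter ℕ : Filter ℕ), K < N :=
  Nat.hyperfilter_le_atTop (eventually_gt_atTop K)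

/-- `f` is at least the identity minus a constant, almost everywhere. -/
def AlmostAboveId (f : ℕ → ℕ) : Prop := ∃ z, ∀ᶠ N in (hyperfilter ℕ : Filter ℕ), N ≤ f N + z

theorem AlmostAboveId.eventually_lt {f : ℕ → ℕ} (hf : AlmostAboveId f) (K : ℕ) :
    ∀ᶠ N in (hyperfilter ℕ : Filter ℕ), K < f N := by
  obtain ⟨z, hz⟩ := hf
  filter_upwards [hz, eventually_hyperfilter_lt (K + z)] with N h₁ h₂
  omega

theorem not_almostAboveId_const (k : ℕ) : ¬ AlmostAboveId fun _ => k := fun h =>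
  (h.eventually_lt k).exists.elim fun _ hN => lt_irrefl k hN

/-- The slack `c` is what makes the notion stable under predecessor. -/
theorem AlmostAboveId.mono {f g : ℕ → ℕ} (hf : AlmostAboveId f) (c : ℕ)
    (h : ∀ᶠ N in (hyperfilter ℕ : Filter ℕ), f N ≤ g N + c) : AlmostAboveId g := by
  obtain ⟨z, hz⟩ := hf
  refine ⟨c + z, ?_⟩
  filter_upwards [hz, h] with N h₁ h₂
  omega

/-- Sequences that are equal almost everywhere, or are both almost above the identity and
congruent modulo `N + j`. -/
def SeqRel (j : ℕ) (f g : ℕ → ℕ) : Prop :=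
  (∀ᶠ N in (hyperfilter ℕ : Filter ℕ), f N = g N) ∨ (AlmostAboveId f ∧ AlmostAboveId g ∧
    ∃ r : ℤ, ∀ᶠ N in (hyperfilter ℕ : Filter ℕ), (f N : ℤ) = g N + r * (N + j))

theorem SeqRel.refl (j : ℕ) (f : ℕ → ℕ) : SeqRel j f f := Or.inl (Eventually.of_forall fun _ => rfl)

theorem SeqRel.symm {j : ℕ} {f g : ℕ → ℕ} (h : SeqRel j f g) : SeqRel j g f := by
  rcases h with h | ⟨hf, hg, r, hr⟩
  · exact Or.inl (h.mono fun N hN => hN.symm)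
  · refine Or.inr ⟨hg, hf, -r, hr.mono fun N hN => ?_⟩
    rw [hN]
    ring

theorem SeqRel.trans {j : ℕ} {f g h : ℕ → ℕ} (h₁ : SeqRel j f g) (h₂ : SeqRel j g h) :
    SeqRel j f h := by
  rcases h₁ with h₁ | ⟨hf, hg, r, hr⟩
  · rcases h₂ with h₂ | ⟨hg, hh, s, hs⟩
    · exact Or.inl (h₁.mp (h₂.mono fun N a b => b.trans a))
    · refine Or.inr ⟨hg.mono 0 (h₁.mono fun N hN => hN.ge), hh, s, ?_⟩
      filter_upwards [h₁, hs] with N a b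
      rw [a, b]
  · rcases h₂ with h₂ | ⟨-, hh, s, hs⟩
    · refine Or.inr ⟨hf, hg.mono 0 (h₂.mono fun N hN => hN.le), r, ?_⟩
      filter_upwards [h₂, hr] with N a b
      rw [b, a]
    · refine Or.inr ⟨hf, hh, r + s, ?_⟩
      filter_upwards [hr, hs] with N a b
      rw [a, b]
      ring

theorem SeqRel.add_right {j : ℕ} {f g : ℕ → ℕ} (h : SeqRel j f g) (e : ℕ → ℕ) :
    SeqRel j (f + e) (g + e) := by
  rcases h with h | ⟨hf, hg, r, hr⟩
  · exact Or.inl (h.mono fun N hN => congrArg (· + e N) hN)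
  · refine Or.inr ⟨hf.mono 0 (Eventually.of_forall fun N => Nat.le_add_right _ _),
      hg.mono 0 (Eventually.of_forall fun N => Nat.le_add_right _ _), r, hr.mono fun N hN => ?_⟩
    simp only [Pi.add_apply, Nat.cast_add, hN]
    ring

theorem SeqRel.add {j : ℕ} {f g f' g' : ℕ → ℕ} (h : SeqRel j f g) (h' : SeqRel j f' g') :
    SeqRel j (f + f') (g + g') := by
  refine (h.add_right f').trans ?_
  rw [add_comm g, add_comm g]
  exact h'.add_right g

/-- Sequences almost above the identity are positive almost everywhere, so truncated subtraction is
exact there and preserves the difference. -/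
theorem SeqRel.sub_one {j : ℕ} {f g : ℕ → ℕ} (h : SeqRel j f g) : SeqRel j (f - 1) (g - 1) := by
  rcases h with h | ⟨hf, hg, r, hr⟩
  · exact Or.inl (h.mono fun N hN => congrArg (· - 1) hN)
  · refine Or.inr ⟨hf.mono 1 (Eventually.of_forall fun N => ?_),
      hg.mono 1 (Eventually.of_forall fun N => ?_), r, ?_⟩
    · simp only [Pi.sub_apply, Pi.one_apply]; omega
    · simp only [Pi.sub_apply, Pi.one_apply]; omega
    · filter_upwards [hr, hf.eventually_lt 0, hg.eventually_lt 0] with N h₀ h₁ h₂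
      simp only [Pi.sub_apply, Pi.one_apply]
      rw [Nat.cast_sub (Nat.one_le_of_lt h₁), Nat.cast_sub (Nat.one_le_of_lt h₂), h₀]
      ring

/-- Sequences that differ almost everywhere are identified for at most one modulus. -/
theorem SeqRel.modulus_unique {f g : ℕ → ℕ} (hne : ∀ᶠ N in (hyperfilter ℕ : Filter ℕ), f N ≠ g N)
    {i j : ℕ} (hi : SeqRel i f g) (hj : SeqRel j f g) : i = j := by
  rcases hi with hi | ⟨-, -, r, hr⟩
  · exact ((hi.and hne).exists.elim fun N hN => hN.2 hN.1).elim
  rcases hj with hj | ⟨-, -, s, hs⟩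
  · exact ((hj.and hne).exists.elim fun N hN => hN.2 hN.1).elim
  -- Equate the two expressions `r(N + i)` and `s(N + j)` for `f N - g N`. The left side below
  -- outgrows the constant right side unless `r = s`; then `r ≠ 0` gives `i = j`.
  have key : ∀ᶠ N : ℕ in (hyperfilter ℕ : Filter ℕ),
      r ≠ 0 ∧ (r - s) * (N : ℤ) = s * j - r * i := by
    filter_upwards [hne, hr, hs] with N h₀ h₁ h₂
    refine ⟨?_, by linarith⟩
    rintro rfl
    exact h₀ (by simpa using h₁)
  obtain ⟨N, ⟨hr0, hN⟩, hlt⟩ :=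
    (key.and (eventually_hyperfilter_lt (s * j - r * i : ℤ).natAbs)).exists
  have hrs : r - s = 0 := by
    by_contra hrs
    have h₁ := congrArg Int.natAbs hN
    rw [Int.natAbs_mul, Int.natAbs_natCast] at h₁
    have h₂ : 0 < (r - s).natAbs := Int.natAbs_pos.2 hrs
    have h₃ := Nat.le_mul_of_pos_left N h₂
    omega
  obtain rfl : r = s := by omega
  rw [hrs, zero_mul] at hN
  have := mul_left_cancel₀ hr0 (sub_eq_zero.1 hN.symm)
  exact_mod_cast this.symm

/-- The setoid of `SeqRel j`. -/
@[reducible] def seqSetoid (j : ℕ) : Setoid (ℕ → ℕ) :=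
  ⟨SeqRel j, SeqRel.refl j, SeqRel.symm, SeqRel.trans⟩

/-- Sequences modulo `SeqRel j`. -/
def SeqModel (j : ℕ) : Type := Quotient (seqSetoid j)

/-- The class of a sequence. -/
def SeqModel.mk (j : ℕ) (f : ℕ → ℕ) : SeqModel j := Quotient.mk (seqSetoid j) f

theorem SeqModel.mk_eq_mk {j : ℕ} {f g : ℕ → ℕ} :
    SeqModel.mk j f = SeqModel.mk j g ↔ SeqRel j f g := Quotient.eq (r := seqSetoid j)

/-- The standard structure on `ℕ`. -/
instance natStructure : LA.Structure ℕ where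
  funMap
    | LAFunc.zero, _ => 0
    | LAFunc.succ, x => x 0 + 1
    | LAFunc.pred, x => x 0 - 1
    | LAFunc.add, x => x 0 + x 1
  RelMap := fun R => Empty.elim R

instance seqStructure (j : ℕ) : LA.Structure (SeqModel j) where
  funMap
    | LAFunc.zero, _ => SeqModel.mk j 0
    | LAFunc.succ, x => Quotient.map (· + 1) (fun _ _ => (SeqRel.add_right · 1)) (x 0)
    | LAFunc.pred, x => Quotient.map (· - 1) (fun _ _ => SeqRel.sub_one) (x 0)
    | LAFunc.add, x => Quotient.map₂ (· + ·) (fun _ _ h _ _ => SeqRel.add h) (x 0) (x 1)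
  RelMap := fun R => Empty.elim R

section SeqModel

variable (j : ℕ) (f g : ℕ → ℕ)

theorem SeqModel.zeroV_eq : zeroV (L := LA) (SeqModel j) = mk j 0 := rfl
theorem SeqModel.addV_mk : addV (mk j f) (mk j g) = mk j (f + g) := rfl

theorem SeqModel.mulV_mk (n : ℕ) : mulV n (mk j f) = mk j fun N => n * f N := by
  induction n with
  | zero => exact congrArg (mk j) (funext fun N => (Nat.zero_mul _).symm)
  | succ n ih =>
    rw [mulV, ih, addV_mk]
    exact congrArg (mk j) (funext fun N => by simp only [Pi.add_apply]; ring)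

theorem SeqModel.iterate_succV_mk (k : ℕ) :
    (succV (L := LA))^[k] (mk j f) = mk j fun N => f N + k := by
  induction k with
  | zero => rfl
  | succ k ih => rw [Function.iterate_succ_apply', ih]; rfl

theorem SeqModel.numV_eq (k : ℕ) : numV (SeqModel j) k = mk j fun _ => k := by
  rw [numV, zeroV_eq, iterate_succV_mk]
  exact congrArg (mk j) (funext fun N => Nat.zero_add k)

/-- A constant sequence is not almost above the identity, so its class is the same as in the
ultrapower. -/
theorem SeqModel.mk_ne_mk_const {f : ℕ → ℕ} {k : ℕ}
    (hf : ∀ᶠ N in (hyperfilter ℕ : Filter ℕ), f N ≠ k) : mk j f ≠ mk j fun _ => k := by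
  rw [Ne, mk_eq_mk]
  rintro (h | ⟨-, h, -⟩)
  · exact (h.and hf).exists.elim fun N hN => hN.2 hN.1
  · exact not_almostAboveId_const k h

theorem SeqModel.isArithmetic : IsArithmetic (SeqModel j) where
  one_ne_zero := mk_ne_mk_const j (f := 0 + 1) (k := 0) (Eventually.of_forall fun _ => one_ne_zero)
  pred_zero := rfl
  pred_succ := Quotient.ind fun f => congrArg (mk j) (add_tsub_cancel_right f 1)
  add_zero := Quotient.ind fun f => congrArg (mk j) (add_zero f)
  add_succ := Quotient.ind₂ fun f g => congrArg (mk j) (add_assoc f g 1).symm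
  add_comm := Quotient.ind₂ fun f g => congrArg (mk j) (add_comm f g)
  add_assoc x y z := Quotient.inductionOn₃ x y z fun e f g =>
    congrArg (mk j) (add_assoc e f g).symm

theorem SeqModel.not_realize_formulaE {k n m : ℕ} (hn : 0 < n) (hnm : n < m) :
    ¬ (formulaE k n m).Realize fun _ => mk j fun N => N + (j + k) := by
  rw [realize_formulaE, mulV_mk, mulV_mk, numV_eq, numV_eq, addV_mk, Classical.not_imp]
  constructor
  -- Positivity of `n` and `m` makes both sides eligible for identification; their difference is
  -- exactly `(n - m)(N + j)`.
  · have habove : ∀ c d : ℕ, 0 < c → AlmostAboveId fun N => c * (N + (j + k)) + d := by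
      refine fun c d hc => ⟨0, Eventually.of_forall fun N => ?_⟩
      have := Nat.le_mul_of_pos_left (N + (j + k)) hc
      dsimp only
      omega
    refine mk_eq_mk.2 (Or.inr ⟨habove n _ hn, habove m 0 (hn.trans hnm), (n : ℤ) - m,
      Eventually.of_forall fun N => ?_⟩)
    simp only [Pi.add_apply]
    push_cast [Nat.cast_sub hnm.le]
    ring
  · refine mk_ne_mk_const j ((eventually_hyperfilter_lt k).mono fun N hN => ?_)
    omega

/-- Terms evaluate coordinatewise, with `η` interpreted as `N` in coordinate `N`. -/
theorem SeqModel.evalAt_mk (w : ℕ → ℕ → ℕ) (t : (WithEta LA).Term ℕ) :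
    evalAt (mk j fun N => N) (fun v => mk j fun N => w N v) t =
      mk j fun N => evalAt N (w N) t := by
  induction t with
  | var v => rfl
  | @func l F ts ih =>
    rcases F with F | F
    · have h : evalAt (mk j fun N => N) (fun v => mk j fun N => w N v) (func (Sum.inl F) ts) =
          Structure.funMap F fun i =>
            evalAt (mk j fun N => N) (fun v => mk j fun N => w N v) (ts i) := rfl
      rw [h]
      simp only [ih]
      cases F <;> rfl
    · match l, F with
      | 0, _ => rfl

end SeqModel

/-! ### `E(η)` is not refuted by a clause set cycle -/

theorem iterate_succV_nat (N : ℕ) : (succV (L := LA))^[N] (zeroV (L := LA) ℕ) = N := by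
  induction N with
  | zero => rfl
  | succ N ih => rw [Function.iterate_succ_apply', ih]; rfl

/-- A literal that fails at almost all natural numbers can hold at the class of the identity for
at most one modulus. -/
theorem Literal.subsingleton_realize_seqModel (w : ℕ → ℕ → ℕ) (l : Literal (WithEta LA))
    (hl : ∀ᶠ N in (hyperfilter ℕ : Filter ℕ),
      ¬ @Literal.Realize _ ℕ (etaStructure LA N) (w N) l) :
    {j | @Literal.Realize _ (SeqModel j) (etaStructure LA (SeqModel.mk j fun N => N))
      (fun v => SeqModel.mk j fun N => w N v) l}.Subsingleton := by
  have hrel : ∀ {i : ℕ}, (WithEta LA).Relations i → False := by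
    rintro i (R | R)
    · exact R.elim
    · exact isEmptyElim R
  have heq : ∀ (j : ℕ) (t u : (WithEta LA).Term ℕ),
      evalAt (SeqModel.mk j fun N => N) (fun v => SeqModel.mk j fun N => w N v) t =
        evalAt (SeqModel.mk j fun N => N) (fun v => SeqModel.mk j fun N => w N v) u ↔
      SeqRel j (fun N => evalAt N (w N) t) fun N => evalAt N (w N) u := by
    intro j t u
    rw [SeqModel.evalAt_mk, SeqModel.evalAt_mk, SeqModel.mk_eq_mk]
  rcases l with (⟨t, u⟩ | ⟨R, -⟩) | (⟨t, u⟩ | ⟨R, -⟩)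
  · intro i hi j hj
    exact SeqRel.modulus_unique hl ((heq i t u).1 hi) ((heq j t u).1 hj)
  · exact (hrel R).elim
  -- A failing negative literal means that the terms agree almost everywhere, hence have the same
  -- class for every modulus.
  · intro i hi
    exact (hi ((heq i t u).2 (Or.inl (hl.mono fun N hN => not_not.1 hN)))).elim
  · exact (hrel R).elim

/-- A clause set cycle fails at the class of the identity for some modulus. -/
theorem IsClauseSetCycle.exists_not_modelsAt_seqModel {C : ClauseSet (WithEta LA)}
    (hC : IsClauseSetCycle LA C) : ∃ j, ¬ C.ModelsAt (SeqModel.mk j fun N => N) := by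
  have hbad : ∀ N : ℕ, ∃ c ∈ C, ∃ w : ℕ → ℕ,
      ¬ @Clause.Realize _ ℕ (etaStructure LA N) w c := by
    intro N
    have h : ¬ C.ModelsAt N := fun h => hC.not_modelsAt_zero (M := ℕ)
      (hC.modelsAt_of_iterate_succ _ N (by rwa [iterate_succV_nat]))
    simpa [ClauseSet.ModelsAt, ClauseSet.Models] using h
  choose c hcC w hw using hbad
  -- The finitely many sets `{N | c N = d}` cover `ℕ`, so one belongs to the ultrafilter.
  obtain ⟨d, hdC, hd⟩ : ∃ d ∈ C, {N | c N = d} ∈ hyperfilter ℕ := by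
    rw [← Ultrafilter.finite_biUnion_mem_iff hC.finite]
    exact univ_mem' fun N => Set.mem_biUnion (hcC N) rfl
  have hfin : (⋃ l ∈ (d : Set (Literal (WithEta LA))), {j | @Literal.Realize _ (SeqModel j)
      (etaStructure LA (SeqModel.mk j fun N => N))
      (fun v => SeqModel.mk j fun N => w N v) l}).Finite := by
    refine d.finite_toSet.biUnion fun l hl =>
      (Literal.subsingleton_realize_seqModel w l ?_).finite
    refine mem_of_superset hd fun N hN hlN => hw N ⟨l, ?_, hlN⟩
    rw [show c N = d from hN]
    exact hl
  obtain ⟨j, hj⟩ := hfin.exists_notMem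
  refine ⟨j, fun h => hj ?_⟩
  obtain ⟨l, hl, hlr⟩ := h d hdC fun v => SeqModel.mk j fun N => w N v
  exact Set.mem_biUnion hl hlr

theorem not_refutedByCycle_clauseSetE {cls : (WithEta LA).Sentence → ClauseSet (WithEta LA)}
    (hcls : IsClausification cls) {k n m : ℕ} (hn : 0 < n) (hnm : n < m) :
    ¬ RefutedByCycle LA (clauseSetE cls k n m) := by
  rintro ⟨C, hC, hEC⟩
  obtain ⟨j, hj⟩ := hC.exists_not_modelsAt_seqModel
  -- The element where `E` fails lies `j + k` successors above the class of the identity.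
  refine hj (hC.modelsAt_of_iterate_succ _ (j + k) ?_)
  rw [SeqModel.iterate_succV_mk]
  let a : SeqModel j := SeqModel.mk j fun N => N + (j + k)
  have : Nonempty (SeqModel j) := ⟨a⟩
  let : (constantsOn Unit).Structure (SeqModel j) := constantsOn.structure fun _ => a
  refine hEC (SeqModel j) ((clauseSetE_models_iff hcls k n m (SeqModel j)).2
    ⟨SeqModel.isArithmetic j, ?_⟩)
  exact SeqModel.not_realize_formulaE j hn hnm

end CSC

theorem mainTheorem3 :
    (∀ cls : (CSC.WithEta CSC.LA).Sentence → CSC.ClauseSet (CSC.WithEta CSC.LA),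
      CSC.IsClausification cls →
        ∀ k n m : ℕ, 0 < n → n < m →
          ¬ CSC.RefutedByCycle CSC.LA (CSC.clauseSetE cls k n m) ∧
          CSC.InconsistentWith (CSC.openInduction CSC.LA) (CSC.clauseSetE cls k n m)) ∧
    (∃ (L : FirstOrder.Language.{0, 0}) (_ : CSC.HasZeroSucc L)
      (D : CSC.ClauseSet (CSC.WithEta L)),
        CSC.InconsistentWith (CSC.openInduction L) D ∧ ¬ CSC.RefutedByCycle L D) := by
  refine ⟨fun cls hcls k n m hn hnm => ⟨CSC.not_refutedByCycle_clauseSetE hcls hn hnm,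
    CSC.inconsistentWith_clauseSetE hcls hnm⟩, ?_⟩
  obtain ⟨cls, hcls⟩ := CSC.exists_isClausification (CSC.WithEta CSC.LA)
  -- Any admissible triple works; over `B` this one says `x = x + x → x = 0`.
  exact ⟨CSC.LA, inferInstance, CSC.clauseSetE cls 0 1 2,
    CSC.inconsistentWith_clauseSetE hcls one_lt_two,
    CSC.not_refutedByCycle_clauseSetE hcls one_pos one_lt_two⟩
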